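/- Let $c \ge 0$ be an integer and, for $n \ge 1$, let $V_n = [n]^c = \{ j_i \mid i \in [c],\ j \in [n]\}$ be a set consisting of $c$ disjoint copies of $[n]=\{1,\dots,n\}$, with the action of $\mathrm{Sym}(n)$ given by $\sigma\cdot j_i = (\sigma(j))_i$; for $m\le n$ regard $V_m\subseteq V_n$ via $j_i\mapsto j_i$. A simplicial complex on $V_n$ is a family of subsets of $V_n$ (its faces) closed under taking subsets; the void family and the family $\{\varnothing\}$ are both allowed, and vertices need not be faces. A facet is an inclusion-maximal face, and the Alexander dual $\Delta^\vee$ of a complex $\Delta$ on $V_n$ is the complex whose faces are the complements $V_n\setminus M$ of the non-faces $M\subseteq V_n$ of $\Delta$. A sequence $(\Delta_n)_{n\ge 1}$ of simplicial complexes $\Delta_n$ on $V_n$ is called a $\mathrm{Sym}$-invariant chain if - $\sigma\cdot F\in\Delta_n$ for all $1\le m\le n$, all $F\in\Delta_m$ and all $\sigma\in\mathrm{Sym}(n)$; and - for every $n\ge 1$ the $c$-fold cone over $\Delta_n$ with apices $V_{n+1}\setminus V_n$ is contained in $\Delta_{n+1}$, that is, $F\cup A\in\Delta_{n+1}$ for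 all $F\in\Delta_n$ and all $A\subseteq V_{n+1}\setminus V_n$. **Theorem.** For any $\mathrm{Sym}$-invariant chain $(\Delta_n)_{n\ge1}$ of simplicial complexes, the number of $\mathrm{Sym}(n)$-orbits of facets of the Alexander dual $\Delta_n^\vee$ is eventually given by a polynomial in $n$: there are a polynomial $p\in\mathbb{Q}[t]$ and an integer $N$ such that this number equals $p(n)$ for all $n\ge N$. -/

import Mathlib

namespace SymChain

/-- A simplicial complex on a vertex set `V`: a family of finite subsets of `V` (its faces) closed
under taking subsets. As in Stanley-Reisner theory, the empty set is allowed as a face, the void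
complex (no faces at all, not even the empty one) is distinguished from the complex whose only
face is the empty set, and vertices need not be faces. For this reason Mathlib's
`AbstractSimplicialComplex`, whose faces are nonempty and contain all singletons, is not used. -/
abbrev SComplex (V : Type*) := LowerSet (Finset V)

/-- The facets of a simplicial complex are its faces that are maximal under inclusion. -/
def SComplex.facets {V : Type*} (Δ : SComplex V) : Set (Finset V) :=
  {F | Maximal (fun G => G ∈ Δ) F}

/-- The Alexander dual: its faces are the complements of the non-faces. -/
def SComplex.alexanderDual {V : Type*} [Fintype V] [DecidableEq V] (Δ : SComplex V) :
    SComplex V where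
  carrier := {G | ∃ M : Finset V, M ∉ Δ ∧ G = Mᶜ}
  lower' := by
    rintro _ H hH ⟨M, hM, rfl⟩
    exact ⟨Hᶜ, fun h => hM (Δ.lower (le_compl_comm.mp hH) h), (compl_compl H).symm⟩

/-- The vertex set `V_n = [n]^c = {j_i | i ∈ [c], j ∈ [n]}`; the vertex `j_i` is `(j, i)`. -/
abbrev Vertex (c n : ℕ) := Fin n × Fin c

/-- The inclusion `V_m ⊆ V_n` for `m ≤ n`, `j_i ↦ j_i`. -/
def vertexIncl (c : ℕ) {m n : ℕ} (h : m ≤ n) : Vertex c m ↪ Vertex c n :=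
  (Fin.castLEEmb h).prodMap (Function.Embedding.refl (Fin c))

/-- The action of `Sym(n)` on subsets of `V_n` induced by `σ • j_i = (σ j)_i`. -/
def permFace {c n : ℕ} (σ : Equiv.Perm (Fin n)) (F : Finset (Vertex c n)) :
    Finset (Vertex c n) :=
  F.map (Equiv.prodCongr σ (Equiv.refl (Fin c))).toEmbedding

/-- The `Sym(n)`-orbit of a subset of `V_n`. -/
def symOrbit {c n : ℕ} (F : Finset (Vertex c n)) : Set (Finset (Vertex c n)) :=
  Set.range fun σ : Equiv.Perm (Fin n) => permFace σ F

/-- The new vertices `V_{n+1} - V_n`. -/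
def newVertices (c n : ℕ) : Finset (Vertex c (n + 1)) :=
  Finset.univ \ Finset.univ.map (vertexIncl c n.le_succ)

/-- The faces of the `c`-fold cone over `Δ` with apices `V_{n+1} - V_n`. -/
def coneFaces {c n : ℕ} (Δ : SComplex (Vertex c n)) : Set (Finset (Vertex c (n + 1))) :=
  {G | ∃ F ∈ Δ, ∃ A ⊆ newVertices c n, G = F.map (vertexIncl c n.le_succ) ∪ A}

/-- `Sym`-invariant chains `(Δ_n)` of simplicial complexes with `Δ_n` on the vertex set `[n]^c`,
indexed by the integers `n ≥ 1`; nothing is required of the value at `n = 0`. -/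
structure IsSymInvariantChain (c : ℕ) (Δ : ∀ n : ℕ, SComplex (Vertex c n)) : Prop where
  perm_mem : ∀ (m n : ℕ) (hmn : m ≤ n), 1 ≤ m → ∀ F ∈ Δ m, ∀ σ : Equiv.Perm (Fin n),
    permFace σ (F.map (vertexIncl c hmn)) ∈ Δ n
  cone_subset : ∀ n : ℕ, 1 ≤ n → coneFaces (Δ n) ⊆ (Δ (n + 1) : Set (Finset (Vertex c (n + 1))))

/-- The number of `Sym(n)`-orbits of facets of a complex on `V_n`. -/
noncomputable def numFacetOrbits {c n : ℕ} (Δ : SComplex (Vertex c n)) : ℕ :=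
  (symOrbit '' Δ.facets).ncard

end SymChain

/-! Facets of the dual are complements of minimal nonfaces. Up to `Sym(n)`, a subset of `V_n` is
determined by its type, the vector counting the columns of each shape `S ⊆ [c]`; its entries sum to
`n`. Invariance makes being a face depend on the type only, and the cone condition makes the face
types an upper set of `ℕ^(2^c)`. Deleting a vertex moves one unit between two entries of the type,
so the types of minimal nonfaces form a Boolean combination of finitely many upper sets
(`isTame_minNonfaceTypes`). By Dickson's lemma its indicator is a linear combination of indicators
of orthants `Set.Ici v`, and the points of an orthant with sum `n` are counted by a binomial
coefficient, polynomial in `n` once `n ≥ ∑ v i`. -/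

namespace SymChain

/-! ### Boolean combinations of upper sets in `ℕ^ι` and their counting functions -/

section Counting

variable {ι : Type*}

/-- The submonoid of functions on `ℕ^ι` formed by the indicators of the principal upper sets. -/
noncomputable def iciIndicators (ι : Type*) : Submonoid ((ι → ℕ) → ℚ) where
  carrier := Set.range fun v : ι → ℕ => (Set.Ici v).indicator 1
  mul_mem' := by
    rintro _ _ ⟨v, rfl⟩ ⟨w, rfl⟩
    exact ⟨v ⊔ w, by simp only [← Set.Ici_inter_Ici, Set.inter_indicator_one]⟩
  one_mem' := ⟨0, by ext; simp⟩

/-- The algebra of functions on `ℕ^ι` generated by the indicators of the principal upper sets. -/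
noncomputable def upperAlgebra (ι : Type*) : Subalgebra ℚ ((ι → ℕ) → ℚ) :=
  Algebra.adjoin ℚ (iciIndicators ι)

/-- The sets whose indicator lies in `upperAlgebra` form a Boolean algebra of sets containing the
upper sets. -/
def IsTame (A : Set (ι → ℕ)) : Prop := A.indicator 1 ∈ upperAlgebra ι

lemma IsTame.compl {A : Set (ι → ℕ)} (hA : IsTame A) : IsTame Aᶜ := by
  rw [IsTame, Set.indicator_compl]
  exact sub_mem (one_mem _) hA

lemma IsTame.inter {A B : Set (ι → ℕ)} (hA : IsTame A) (hB : IsTame B) : IsTame (A ∩ B) := by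
  rw [IsTame, Set.inter_indicator_one]
  exact mul_mem hA hB

lemma isTame_univ : IsTame (Set.univ : Set (ι → ℕ)) := by
  rw [IsTame, Set.indicator_univ]
  exact one_mem _

lemma IsTame.biInter {α : Type*} {s : Set α} (hs : s.Finite) {A : α → Set (ι → ℕ)}
    (hA : ∀ x ∈ s, IsTame (A x)) : IsTame (⋂ x ∈ s, A x) := by
  induction s, hs using Set.Finite.induction_on with
  | empty => simpa using isTame_univ
  | insert _ _ ih =>
    rw [Set.biInter_insert]
    exact (hA _ (by simp)).inter (ih fun x hx => hA x (by simp [hx]))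

lemma IsTame.iInter {α : Type*} [Finite α] {A : α → Set (ι → ℕ)} (hA : ∀ x, IsTame (A x)) :
    IsTame (⋂ x, A x) := by
  simpa using IsTame.biInter Set.finite_univ fun x _ => hA x

lemma IsTame.biUnion {α : Type*} {s : Set α} (hs : s.Finite) {A : α → Set (ι → ℕ)}
    (hA : ∀ x ∈ s, IsTame (A x)) : IsTame (⋃ x ∈ s, A x) := by
  rw [← compl_compl (⋃ x ∈ s, A x), Set.compl_iUnion₂]
  exact (IsTame.biInter hs fun x hx => (hA x hx).compl).compl

lemma isTame_Ici (v : ι → ℕ) : IsTame (Set.Ici v) :=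
  Algebra.subset_adjoin ⟨v, rfl⟩

/-- Dickson's lemma: the minimal elements form an antichain, hence are finitely many, and their
orthants cover `U`. -/
lemma isTame_of_isUpperSet [Finite ι] {U : Set (ι → ℕ)} (hU : IsUpperSet U) : IsTame U := by
  have hfin : {v | Minimal (· ∈ U) v}.Finite :=
    WellQuasiOrderedLE.finite_of_isAntichain (setOfPred_minimal_antichain _)
  have : U = ⋃ v ∈ {v | Minimal (· ∈ U) v}, Set.Ici v := by
    ext a
    simp only [Set.mem_iUnion, Set.mem_Ici, Set.mem_ofPred_eq, exists_prop]
    refine ⟨fun ha => ?_, fun ⟨v, hv, hva⟩ => hU hva hv.prop⟩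
    obtain ⟨v, hva, hv⟩ := exists_minimal_le_of_wellFoundedLT (· ∈ U) a ha
    exact ⟨v, hv, hva⟩
  rw [this]
  exact IsTame.biUnion hfin fun v _ => isTame_Ici v

variable [Fintype ι] [DecidableEq ι]

/-- Stars and bars, with a lower index independent of `n` so that the count is visibly polynomial.
-/
lemma card_piAntidiag_univ [Nonempty ι] (n : ℕ) :
    (Finset.piAntidiag (Finset.univ : Finset ι) n).card
      = (n + (Fintype.card ι - 1)).choose (Fintype.card ι - 1) := by
  have h : (Finset.piAntidiag (Finset.univ : Finset ι) n).card = Fintype.card (Sym ι n) :=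
    Finset.card_eq_of_equiv_fintype
      ((Equiv.subtypeEquivRight (by simp)).trans (Sym.equivNatSumOfFintype ι n).symm)
  rw [h, Sym.card_sym_eq_choose]
  have := Fintype.card_pos (α := ι)
  rw [← Nat.choose_symm_of_eq_add (n := n + (Fintype.card ι - 1)) (a := n) (by omega)]
  congr 1
  omega

lemma sum_indicator_Ici (v : ι → ℕ) {n : ℕ} (hn : ∑ i, v i ≤ n) :
    ∑ a ∈ Finset.piAntidiag Finset.univ n, (Set.Ici v).indicator (1 : (ι → ℕ) → ℚ) a
      = (Finset.piAntidiag (Finset.univ : Finset ι) (n - ∑ i, v i)).card := by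
  classical
  simp only [Set.indicator_apply, Pi.one_apply, Set.mem_Ici]
  rw [← Finset.sum_filter, Finset.sum_const, nsmul_one]
  congr 1
  symm
  refine Finset.card_bij' (fun a _ => a + v) (fun a _ => a - v) ?_ ?_ ?_ ?_
  · intro a ha
    simp only [Finset.mem_piAntidiag, Finset.mem_filter] at ha ⊢
    simp [Finset.sum_add_distrib, ha.1]
    omega
  · intro a ha
    simp only [Finset.mem_piAntidiag, Finset.mem_filter] at ha ⊢
    have : Finset.univ.sum (a - v) + ∑ i, v i = Finset.univ.sum a := by
      rw [← Finset.sum_add_distrib]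
      exact Finset.sum_congr rfl fun i _ => Nat.sub_add_cancel (ha.2 i)
    refine ⟨by omega, by simp⟩
  · intro a _
    simp
  · intro a ha
    exact tsub_add_cancel_of_le (Finset.mem_filter.1 ha).2

lemma exists_polynomial_sum [Nonempty ι] {f : (ι → ℕ) → ℚ} (hf : f ∈ upperAlgebra ι) :
    ∃ p : Polynomial ℚ, ∃ N : ℕ, ∀ n, N ≤ n →
      ∑ a ∈ Finset.piAntidiag Finset.univ n, f a = p.eval (n : ℚ) := by
  -- The generators are closed under products, so the algebra is their linear span and only linear
  -- combinations need treatment.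
  rw [upperAlgebra, ← Subalgebra.mem_toSubmodule, Algebra.adjoin_eq_span,
    Submonoid.closure_eq] at hf
  induction hf using Submodule.span_induction with
  | mem x hx =>
    obtain ⟨v, rfl⟩ := hx
    refine ⟨Polynomial.preHilbertPoly ℚ (Fintype.card ι - 1) (∑ i, v i), ∑ i, v i, fun n hn => ?_⟩
    rw [sum_indicator_Ici v hn, card_piAntidiag_univ,
      Polynomial.preHilbertPoly_eq_choose_sub_add ℚ _ hn]
  | zero => exact ⟨0, 0, by simp⟩
  | add x y _ _ hx hy =>
    obtain ⟨p, N, hp⟩ := hx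
    obtain ⟨q, M, hq⟩ := hy
    refine ⟨p + q, max N M, fun n hn => ?_⟩
    simp [Finset.sum_add_distrib, hp n (le_of_max_le_left hn), hq n (le_of_max_le_right hn)]
  | smul r x _ hx =>
    obtain ⟨p, N, hp⟩ := hx
    refine ⟨r • p, N, fun n hn => ?_⟩
    simp [← Finset.mul_sum, hp n hn]

/-- The number of points of a tame set with coordinate sum `n` is eventually polynomial in `n`. -/
lemma IsTame.exists_polynomial_ncard [Nonempty ι] {A : Set (ι → ℕ)} (hA : IsTame A) :
    ∃ p : Polynomial ℚ, ∃ N : ℕ, ∀ n, N ≤ n →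
      ({a | ∑ i, a i = n ∧ a ∈ A}.ncard : ℚ) = p.eval (n : ℚ) := by
  classical
  obtain ⟨p, N, hp⟩ := exists_polynomial_sum hA
  refine ⟨p, N, fun n hn => ?_⟩
  rw [← hp n hn]
  have : {a | ∑ i, a i = n ∧ a ∈ A}
      = ((Finset.piAntidiag Finset.univ n).filter (· ∈ A) : Finset (ι → ℕ)) := by
    ext a
    simp
  rw [this, Set.ncard_coe_finset]
  simp [Set.indicator_apply]

end Counting

/-! ### Column types as a complete invariant of `Sym(n)`-orbits -/

section Types

variable {c n : ℕ}

/-- The part of `F` in the `j`-th column `{j_i | i ∈ [c]}`, as a subset of `[c]`. -/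
def column (F : Finset (Vertex c n)) (j : Fin n) : Finset (Fin c) :=
  Finset.univ.filter fun i => (j, i) ∈ F

/-- The subset of `V_n` with prescribed columns. -/
def ofColumns (g : Fin n → Finset (Fin c)) : Finset (Vertex c n) :=
  Finset.univ.filter fun x => x.2 ∈ g x.1

@[simp] lemma mem_column {F : Finset (Vertex c n)} {j : Fin n} {i : Fin c} :
    i ∈ column F j ↔ (j, i) ∈ F := by simp [column]

@[simp] lemma mem_ofColumns {g : Fin n → Finset (Fin c)} {x : Vertex c n} :
    x ∈ ofColumns g ↔ x.2 ∈ g x.1 := by simp [ofColumns]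

@[simp] lemma column_ofColumns (g : Fin n → Finset (Fin c)) : column (ofColumns g) = g := by
  ext j i; simp

lemma column_injective : Function.Injective (column (c := c) (n := n)) := by
  intro F G h
  ext ⟨j, i⟩
  rw [← mem_column, h, mem_column]

/-- The number of columns of each shape. -/
def typ (F : Finset (Vertex c n)) (S : Finset (Fin c)) : ℕ :=
  (Finset.univ.filter fun j => column F j = S).card

lemma sum_typ (F : Finset (Vertex c n)) : ∑ S, typ F S = n := by
  simp only [typ]
  rw [← Finset.card_eq_sum_card_fiberwise (by simp)]
  simp

lemma typ_eq_sum (F : Finset (Vertex c n)) : typ F = ∑ j, Pi.single (column F j) 1 := by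
  ext S
  rw [typ, Finset.card_filter, Finset.sum_apply]
  exact Finset.sum_congr rfl fun j _ => by simp [Pi.single_apply, eq_comm]

lemma exists_typ_eq {a : Finset (Fin c) → ℕ} (ha : ∑ S, a S = n) :
    ∃ F : Finset (Vertex c n), typ F = a := by
  have e : Fin n ≃ Σ S, Fin (a S) := Fintype.equivOfCardEq (by simp [ha])
  refine ⟨ofColumns fun j => (e j).1, ?_⟩
  ext S
  rw [typ, column_ofColumns, ← Fintype.card_subtype,
    Fintype.card_congr (e.subtypeEquiv (q := fun x => x.1 = S) fun _ => Iff.rfl),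
    Fintype.card_congr (Equiv.sigmaSubtype S), Fintype.card_fin]

lemma mem_permFace {σ : Equiv.Perm (Fin n)} {F : Finset (Vertex c n)} {x : Vertex c n} :
    x ∈ permFace σ F ↔ (σ.symm x.1, x.2) ∈ F := by
  rw [permFace, Finset.mem_map_equiv]
  rfl

lemma permFace_compl (σ : Equiv.Perm (Fin n)) (F : Finset (Vertex c n)) :
    permFace σ Fᶜ = (permFace σ F)ᶜ := by
  ext x
  simp [mem_permFace]

lemma permFace_mul (σ τ : Equiv.Perm (Fin n)) (F : Finset (Vertex c n)) :
    permFace (σ * τ) F = permFace σ (permFace τ F) := by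
  ext x
  simp [mem_permFace, Equiv.Perm.mul_def]

lemma permFace_one (F : Finset (Vertex c n)) : permFace 1 F = F := by
  ext x
  rw [mem_permFace]
  rfl

lemma column_permFace (σ : Equiv.Perm (Fin n)) (F : Finset (Vertex c n)) (j : Fin n) :
    column (permFace σ F) (σ j) = column F j := by
  ext i
  simp [mem_permFace]

lemma typ_permFace (σ : Equiv.Perm (Fin n)) (F : Finset (Vertex c n)) :
    typ (permFace σ F) = typ F := by
  simp_rw [typ_eq_sum, ← column_permFace σ F]
  exact (Equiv.sum_comp σ fun j => Pi.single (column (permFace σ F) j) 1).symm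

/-- Equal types mean equally many columns of each shape; bijections between these fibres glue to a
permutation. -/
lemma typ_eq_typ_iff {F G : Finset (Vertex c n)} :
    typ F = typ G ↔ ∃ σ : Equiv.Perm (Fin n), permFace σ F = G := by
  refine ⟨fun h => ?_, fun ⟨σ, h⟩ => h ▸ (typ_permFace σ F).symm⟩
  have e : ∀ S, {j // column F j = S} ≃ {j // column G j = S} := fun S =>
    Fintype.equivOfCardEq (by
      rw [Fintype.card_subtype, Fintype.card_subtype]
      exact congrFun h S)
  refine ⟨Equiv.ofFiberEquiv e, column_injective (funext fun j => ?_)⟩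
  obtain ⟨k, rfl⟩ := (Equiv.ofFiberEquiv e).surjective j
  rw [column_permFace]
  exact (Equiv.ofFiberEquiv_map e k).symm

lemma symOrbit_eq_symOrbit_iff {F G : Finset (Vertex c n)} :
    symOrbit F = symOrbit G ↔ ∃ σ : Equiv.Perm (Fin n), permFace σ F = G := by
  refine ⟨fun h => ?_, ?_⟩
  · have : G ∈ symOrbit F := h ▸ ⟨1, permFace_one G⟩
    exact this
  · rintro ⟨σ, rfl⟩
    ext H
    constructor
    · rintro ⟨τ, rfl⟩
      exact ⟨τ * σ⁻¹, by simp [← permFace_mul]⟩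
    · rintro ⟨τ, rfl⟩
      exact ⟨τ * σ, permFace_mul _ _ _⟩

lemma symOrbit_eq_symOrbit_iff_typ_compl {F G : Finset (Vertex c n)} :
    symOrbit F = symOrbit G ↔ typ Fᶜ = typ Gᶜ := by
  simp [symOrbit_eq_symOrbit_iff, typ_eq_typ_iff, permFace_compl]

/-- Only column `j` changes shape. The additive form avoids truncated subtraction. -/
lemma typ_erase {F : Finset (Vertex c n)} {j : Fin n} {i : Fin c} :
    typ (F.erase (j, i)) + Pi.single (column F j) 1
      = typ F + Pi.single ((column F j).erase i) 1 := by
  have h₁ : column (F.erase (j, i)) j = (column F j).erase i := by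
    ext k
    simp
  have h₂ : ∀ k ∈ Finset.univ.erase j, column (F.erase (j, i)) k = column F k := by
    intro k hk
    ext l
    have : k ≠ j := Finset.ne_of_mem_erase hk
    simp [this]
  rw [typ_eq_sum, typ_eq_sum, ← Finset.add_sum_erase _ _ (Finset.mem_univ j),
    ← Finset.add_sum_erase _ _ (Finset.mem_univ j), h₁,
    Finset.sum_congr rfl fun k hk => by rw [h₂ k hk]]
  abel

/-- The face of the cone over `F` obtained by adding one column of shape `S`. -/
def coneFace (F : Finset (Vertex c n)) (S : Finset (Fin c)) : Finset (Vertex c (n + 1)) :=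
  F.map (vertexIncl c n.le_succ) ∪ Finset.univ.filter fun x => x.1 = Fin.last n ∧ x.2 ∈ S

lemma column_coneFace_castSucc (F : Finset (Vertex c n)) (S : Finset (Fin c)) (j : Fin n) :
    column (coneFace F S) j.castSucc = column F j := by
  ext i
  simp only [mem_column, coneFace, Finset.mem_union, Finset.mem_map, Finset.mem_filter, Fin.ext_iff,
    Fin.val_castSucc, Fin.val_last, j.isLt.ne, false_and, and_false, or_false]
  refine ⟨?_, fun h => ⟨_, h, rfl⟩⟩
  rintro ⟨⟨k, l⟩, h, hx⟩
  obtain ⟨hk, rfl⟩ := Prod.ext_iff.1 hx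
  obtain rfl : k = j := Fin.castSucc_injective n hk
  exact h

lemma column_coneFace_last (F : Finset (Vertex c n)) (S : Finset (Fin c)) :
    column (coneFace F S) (Fin.last n) = S := by
  ext i
  simp [coneFace, vertexIncl, Prod.ext_iff, Fin.ext_iff, fun k : Fin n => k.isLt.ne]

lemma typ_coneFace (F : Finset (Vertex c n)) (S : Finset (Fin c)) :
    typ (coneFace F S) = typ F + Pi.single S 1 := by
  simp [typ_eq_sum, Fin.sum_univ_castSucc, column_coneFace_castSucc, column_coneFace_last]

lemma coneFace_mem_coneFaces {Δ : SComplex (Vertex c n)} {F : Finset (Vertex c n)} (hF : F ∈ Δ)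
    (S : Finset (Fin c)) : coneFace F S ∈ coneFaces Δ := by
  refine ⟨F, hF, _, ?_, rfl⟩
  rintro ⟨j, i⟩ hx
  obtain ⟨rfl, -⟩ : j = Fin.last n ∧ i ∈ S := by simpa using hx
  simp [newVertices, vertexIncl, Fin.ext_iff, fun k : Fin n => k.isLt.ne]

end Types

/-! ### Dual facets and upper sets of types -/

lemma mem_facets_alexanderDual_iff {V : Type*} [Fintype V] [DecidableEq V] {Δ : SComplex V}
    {G : Finset V} :
    G ∈ (SComplex.alexanderDual Δ).facets ↔ Gᶜ ∉ Δ ∧ ∀ x ∈ Gᶜ, Gᶜ.erase x ∈ Δ := by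
  have hmem : ∀ H : Finset V, H ∈ SComplex.alexanderDual Δ ↔ Hᶜ ∉ Δ := by
    intro H
    constructor
    · rintro ⟨M, hM, rfl⟩
      rwa [compl_compl]
    · exact fun h => ⟨Hᶜ, h, (compl_compl H).symm⟩
  change Maximal (fun s => s ∈ SComplex.alexanderDual Δ) G ↔ _
  rw [Finset.maximal_iff_forall_insert (P := fun s => s ∈ SComplex.alexanderDual Δ)
    fun s t ht hst => (SComplex.alexanderDual Δ).lower hst ht]
  simp [hmem, Finset.compl_insert]

/-- The types of the faces of the complexes `Δ n` with `n ≥ 1`. -/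
def faceTypes {c : ℕ} (Δ : ∀ n : ℕ, SComplex (Vertex c n)) : Set (Finset (Fin c) → ℕ) :=
  {a | ∃ n, 1 ≤ n ∧ ∃ F ∈ Δ n, typ F = a}

/-- The vectors that become members of `D` when one unit is moved from entry `T` to entry `S`. -/
def moveTypes {ι : Type*} [DecidableEq ι] (D : Set (ι → ℕ)) (T S : ι) : Set (ι → ℕ) :=
  {a | ∃ b ∈ D, b + Pi.single T 1 = a + Pi.single S 1}

lemma isUpperSet_moveTypes {ι : Type*} [DecidableEq ι] {D : Set (ι → ℕ)} (hD : IsUpperSet D)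
    (T S : ι) : IsUpperSet (moveTypes D T S) := by
  rintro a a' haa' ⟨b, hb, h⟩
  obtain ⟨d, rfl⟩ := exists_add_of_le haa'
  refine ⟨b + d, hD (by simp) hb, ?_⟩
  rw [add_right_comm, h, add_right_comm]

lemma single_one_le_iff {ι : Type*} [DecidableEq ι] {a : ι → ℕ} {S : ι} :
    Pi.single S 1 ≤ a ↔ 0 < a S := by
  refine ⟨fun h => by simpa [Nat.succ_le_iff] using h S, fun h T => ?_⟩
  obtain rfl | hT := eq_or_ne T S
  · simpa [Nat.succ_le_iff] using h
  · simp [hT]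

lemma isUpperSet_of_add_single {ι : Type*} [DecidableEq ι] [Fintype ι] {D : Set (ι → ℕ)}
    (hD : ∀ a ∈ D, ∀ S, a + Pi.single S 1 ∈ D) : IsUpperSet D := by
  intro a b hab ha
  obtain ⟨d, rfl⟩ := exists_add_of_le hab
  clear hab
  -- The difference `d` is built up one unit at a time.
  induction hn : ∑ i, d i generalizing d with
  | zero =>
    have : d = 0 := by ext i; simpa using (Finset.sum_eq_zero_iff.1 hn) i
    simpa [this]
  | succ k ih =>
    obtain ⟨S, -, hS⟩ := Finset.exists_ne_zero_of_sum_ne_zero (by omega : ∑ i, d i ≠ 0)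
    obtain ⟨e, rfl⟩ := exists_add_of_le
      (single_one_le_iff.2 (Nat.pos_of_ne_zero hS))
    have hk : ∑ i, e i = k := by
      simp only [Pi.add_apply, Finset.sum_add_distrib, Finset.sum_pi_single', Finset.mem_univ,
        if_true] at hn
      omega
    rw [add_comm (Pi.single S 1), ← add_assoc]
    exact hD _ (ih e hk) S

/-! ### Types of minimal nonfaces of a chain -/

section Chain

variable {c : ℕ} {Δ : ∀ n : ℕ, SComplex (Vertex c n)}

lemma IsSymInvariantChain.isUpperSet_faceTypes (hΔ : IsSymInvariantChain c Δ) :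
    IsUpperSet (faceTypes Δ) := by
  refine isUpperSet_of_add_single ?_
  rintro _ ⟨n, hn, F, hF, rfl⟩ S
  exact ⟨n + 1, by omega, coneFace F S,
    hΔ.cone_subset n hn (coneFace_mem_coneFaces hF S), typ_coneFace F S⟩

lemma IsSymInvariantChain.typ_mem_faceTypes_iff (hΔ : IsSymInvariantChain c Δ) {n : ℕ}
    (hn : 1 ≤ n) {F : Finset (Vertex c n)} : typ F ∈ faceTypes Δ ↔ F ∈ Δ n := by
  refine ⟨?_, fun h => ⟨n, hn, F, h, rfl⟩⟩
  rintro ⟨m, -, G, hG, h⟩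
  -- The type records `n` as its sum, so the face witnessing membership lies in `Δ n` itself.
  obtain rfl : m = n := by rw [← sum_typ G, h, sum_typ]
  obtain ⟨σ, rfl⟩ := typ_eq_typ_iff.1 h
  have : G.map (vertexIncl c le_rfl) = G := Finset.map_refl
  simpa [this] using hΔ.perm_mem m m le_rfl hn G hG σ

/-- The types of the minimal nonfaces of the complexes `Δ n` with `n ≥ 1`. -/
def minNonfaceTypes (Δ : ∀ n : ℕ, SComplex (Vertex c n)) : Set (Finset (Fin c) → ℕ) :=
  (faceTypes Δ)ᶜ ∩ ⋂ T : Finset (Fin c), ⋂ i : T,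
    {a | Pi.single T 1 ≤ a ∧ a ∉ moveTypes (faceTypes Δ) T (T.erase i)}ᶜ

lemma IsSymInvariantChain.isTame_minNonfaceTypes (hΔ : IsSymInvariantChain c Δ) :
    IsTame (minNonfaceTypes Δ) :=
  (isTame_of_isUpperSet hΔ.isUpperSet_faceTypes).compl.inter <| IsTame.iInter fun _ =>
    IsTame.iInter fun _ => ((isTame_Ici _).inter
      (isTame_of_isUpperSet (isUpperSet_moveTypes hΔ.isUpperSet_faceTypes _ _)).compl).compl

/-- By `typ_erase`, deleting `(j, i)` from a column of shape `T` is a move from `T` to `T.erase i`.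
The guard `Pi.single T 1 ≤ a` limits the condition to shapes that occur. -/
lemma IsSymInvariantChain.typ_mem_minNonfaceTypes_iff (hΔ : IsSymInvariantChain c Δ) {n : ℕ}
    (hn : 1 ≤ n) {M : Finset (Vertex c n)} :
    typ M ∈ minNonfaceTypes Δ ↔ M ∉ Δ n ∧ ∀ x ∈ M, M.erase x ∈ Δ n := by
  simp only [minNonfaceTypes, Set.mem_inter_iff, Set.mem_compl_iff, Set.mem_iInter,
    Set.mem_ofPred_eq, hΔ.typ_mem_faceTypes_iff hn, not_and, not_not, single_one_le_iff]
  refine and_congr_right fun _ => ⟨fun h => ?_, fun h => ?_⟩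
  · rintro ⟨j, i⟩ hx
    obtain ⟨b, hb, hbe⟩ := h (column M j) ⟨i, mem_column.2 hx⟩
      (Finset.card_pos.2 ⟨j, by simp⟩)
    rw [← typ_erase] at hbe
    rwa [← hΔ.typ_mem_faceTypes_iff hn, ← add_right_cancel hbe]
  · rintro T ⟨i, hi⟩ hT
    obtain ⟨j, hj⟩ := Finset.card_pos.1 hT
    obtain rfl : column M j = T := by simpa using hj
    exact ⟨_, (hΔ.typ_mem_faceTypes_iff hn).2 (h (j, i) (mem_column.1 hi)), typ_erase⟩

lemma IsSymInvariantChain.numFacetOrbits_alexanderDual (hΔ : IsSymInvariantChain c Δ) {n : ℕ}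
    (hn : 1 ≤ n) :
    numFacetOrbits (SComplex.alexanderDual (Δ n))
      = {a | ∑ S, a S = n ∧ a ∈ minNonfaceTypes Δ}.ncard := by
  have himage : {a | ∑ S, a S = n ∧ a ∈ minNonfaceTypes Δ}
      = (fun G => typ Gᶜ) '' (SComplex.alexanderDual (Δ n)).facets := by
    ext a
    constructor
    · rintro ⟨hsum, ha⟩
      obtain ⟨M, rfl⟩ := exists_typ_eq hsum
      refine ⟨Mᶜ, ?_, by simp⟩
      rw [mem_facets_alexanderDual_iff, compl_compl]
      exact (hΔ.typ_mem_minNonfaceTypes_iff hn).1 ha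
    · rintro ⟨G, hG, rfl⟩
      exact ⟨sum_typ _,
        (hΔ.typ_mem_minNonfaceTypes_iff hn).2 (mem_facets_alexanderDual_iff.1 hG)⟩
  rw [himage, numFacetOrbits]
  -- The type of the complement factors through the orbit by a map `e` injective on orbits, so types
  -- and orbits are equinumerous.
  obtain ⟨e, he⟩ := (Function.factorsThrough_iff
    (f := symOrbit (c := c) (n := n)) (fun G => typ Gᶜ)).1
    fun _ _ h => symOrbit_eq_symOrbit_iff_typ_compl.1 h
  rw [he, Set.image_comp]
  refine (Set.InjOn.ncard_image ?_).symm
  rintro _ ⟨F, -, rfl⟩ _ ⟨G, -, rfl⟩ h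
  exact symOrbit_eq_symOrbit_iff_typ_compl.2
    ((congrFun he F).trans (h.trans (congrFun he G).symm))

end Chain

end SymChain

theorem mainTheorem2 (c : ℕ) (Δ : ∀ n : ℕ, SymChain.SComplex (SymChain.Vertex c n))
    (hΔ : SymChain.IsSymInvariantChain c Δ) :
    ∃ p : Polynomial ℚ, ∃ N : ℕ, ∀ n : ℕ, N ≤ n →
      (SymChain.numFacetOrbits (SymChain.SComplex.alexanderDual (Δ n)) : ℚ) = p.eval (n : ℚ) := by
  obtain ⟨p, N, hp⟩ := hΔ.isTame_minNonfaceTypes.exists_polynomial_ncard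
  -- The chain is unconstrained at `n = 0`, hence the bound by `1`.
  refine ⟨p, max N 1, fun n hn => ?_⟩
  rw [hΔ.numFacetOrbits_alexanderDual (le_of_max_le_right hn), hp n (le_of_max_le_left hn)]
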